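/- **Theorem.** Let $F$ be a finite field with $|F|=q$, let $\lambda\in F^\times$ have multiplicative order $t$, and let $\alpha,\alpha'>0$ be integers with $\alpha'\equiv\alpha\pmod t$ and $\gcd(\alpha,t)=1$; set $\alpha''=\min\{\alpha,\alpha'\}$. For $x\in[0,1-q^{-1}]$ let $$h_q(x)=x\log_q(q-1)-x\log_q x-(1-x)\log_q(1-x)\qquad(0\log_q 0=0).$$ For an integer $n>0$, a double $\lambda$-twisted code of ratio $\alpha'/\alpha$ and cycle length $(\alpha' n,\alpha n)$ is an $F[X]$-submodule $C$ of $$\big(F[X]/\langle X^{\alpha' n}-\lambda\rangle\big)\times\big(F[X]/\langle X^{\alpha n}-\lambda\rangle\big).$$ Its elements are regarded as words of length $\alpha' n+\alpha n$ over $F$ through the coefficients of the representatives of degree less than $\alpha' n$ and less than $\alpha n$. Its length is $\alpha' n+\alpha n$, its rate is $\mathrm R(C)=\frac{\log_q|C|}{\alpha' n+\alpha n}$, and, for $C\neq 0$, its relative minimum distance $\Delta(C)$ is the minimum Hamming weight of a nonzero element of $C$ divided by $\alpha' n+\alpha n$. Let $\delta\in(0,1-q^{-1})$ satisfy $\frac{\alpha'+\alpha}{2\alpha''}\,\delta\le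 1-q^{-1}$ and $h_q\!\big(\frac{\alpha'+\alpha}{2\alpha''}\,\delta\big)<\frac12$. Then there are integers $n_1,n_2,\dots>0$ with $\gcd(n_i,qt)=1$ and nonzero double $\lambda$-twisted codes $C_i$ over $F$ of ratio $\alpha'/\alpha$ and cycle length $(\alpha' n_i,\alpha n_i)$, $i=1,2,\dots$, such that the length of $C_i$ goes to infinity, $\lim_{i\to\infty}\mathrm R(C_i)=\frac1{\alpha'+\alpha}$, and $\Delta(C_i)>\delta$ for all $i$. -/

import Mathlib

open Polynomial Filter Topology

namespace DoubleTwisted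

/-- The `q`-ary entropy function
`h_q(x) = x log_q (q-1) - x log_q x - (1-x) log_q (1-x)`, to be used for `0 ≤ x ≤ 1 - 1/q`.
Since `Real.logb q 0 = 0`, the convention `0 log_q 0 = 0` holds. -/
noncomputable def entropy (q : ℕ) (x : ℝ) : ℝ :=
  x * Real.logb q ((q : ℝ) - 1) - x * Real.logb q x - (1 - x) * Real.logb q (1 - x)

/-- The `F[X]`-module (and `F`-algebra) `F[X] / ⟨X ^ m - lam⟩`. -/
abbrev Circle {F : Type*} [Field F] (lam : Fˣ) (m : ℕ) : Type _ :=
  F[X] ⧸ Ideal.span {(X ^ m - C (lam : F) : F[X])}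

/-- The word `(c₀, …, c_{m-1}) ∈ F ^ m` of an element `c` of `F[X] / ⟨X ^ m - lam⟩`:
the coefficients of its unique representative of degree `< m`
(the remainder of any representative on division by `X ^ m - lam`). -/
noncomputable def word {F : Type*} [Field F] (lam : Fˣ) (m : ℕ) (c : Circle lam m) : Fin m → F :=
  fun i => (Function.surjInv Ideal.Quotient.mk_surjective c %ₘ
    (X ^ m - C (lam : F))).coeff (i : ℕ)

/-- The word does not depend on the representative. -/
theorem word_mk {F : Type*} [Field F] (lam : Fˣ) {m : ℕ} (hm : m ≠ 0) (p : F[X]) (i : Fin m) :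
    word lam m (Ideal.Quotient.mk _ p) i = (p %ₘ (X ^ m - C (lam : F))).coeff (i : ℕ) := by
  have hmonic : (X ^ m - C (lam : F)).Monic := monic_X_pow_sub_C _ hm
  have h := Function.surjInv_eq
    (Ideal.Quotient.mk_surjective (I := Ideal.span {(X ^ m - C (lam : F) : F[X])}))
    (Ideal.Quotient.mk _ p)
  rw [Ideal.Quotient.eq, Ideal.mem_span_singleton, ← modByMonic_eq_zero_iff_dvd hmonic,
    sub_modByMonic, sub_eq_zero] at h
  unfold word
  rw [h]

/-- A double `lam`-twisted code of ratio `a' / a` and cycle length `(a' n, a n)` over `F`: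
an `F[X]`-submodule of `F[X]/⟨X ^ (a' n) - lam⟩ × F[X]/⟨X ^ (a n) - lam⟩`. -/
abbrev Code {F : Type*} [Field F] (lam : Fˣ) (a' a n : ℕ) : Type _ :=
  Submodule F[X] (Circle lam (a' * n) × Circle lam (a * n))

open Classical in
/-- The Hamming weight of a pair `(c', c)`, as a word of length `a' n + a n`. -/
noncomputable def weight {F : Type*} [Field F] {lam : Fˣ} {a' a n : ℕ}
    (c : Circle lam (a' * n) × Circle lam (a * n)) : ℕ :=
  hammingNorm (word lam (a' * n) c.1) + hammingNorm (word lam (a * n) c.2)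

/-- The minimum Hamming weight of the nonzero codewords, which for the additive code `K` is its
minimum distance (by the convention for `sInf` on `ℕ` it is `0` for the zero code). -/
noncomputable def minWeight {F : Type*} [Field F] {lam : Fˣ} {a' a n : ℕ}
    (K : Code lam a' a n) : ℕ :=
  sInf {w : ℕ | ∃ c ∈ K, c ≠ 0 ∧ weight c = w}

/-- The code length `a' n + a n`. -/
def length {F : Type*} [Field F] {lam : Fˣ} {a' a n : ℕ} (_K : Code lam a' a n) : ℕ :=
  a' * n + a * n

/-- The relative minimum distance `Δ(K)`: minimum distance over code length. -/
noncomputable def relDist {F : Type*} [Field F] {lam : Fˣ} {a' a n : ℕ}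
    (K : Code lam a' a n) : ℝ :=
  (minWeight K : ℝ) / (length K : ℝ)

/-- The rate `log_q |K| / (a' n + a n)`, where `q = |F|`. -/
noncomputable def rate {F : Type*} [Field F] [Fintype F] {lam : Fˣ} {a' a n : ℕ}
    (K : Code lam a' a n) : ℝ :=
  Real.logb (Fintype.card F) (Nat.card K) / (length K : ℝ)

end DoubleTwisted

namespace DoubleTwisted

/-! ### Entropy bound for Hamming balls. -/

/-- The number of words of length `N` and weight at most `θ N` is at most `q ^ (N h_q(θ))`. -/
theorem card_le_of_hammingNorm_le {F κ : Type*} [Field F] [Fintype F] [DecidableEq F] [Fintype κ]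
    {θ : ℝ} (h0 : 0 < θ) (h1 : θ ≤ 1 - 1 / (Fintype.card F : ℝ)) (W : Finset (κ → F))
    (hW : ∀ w ∈ W, (hammingNorm w : ℝ) ≤ θ * Fintype.card κ) :
    (W.card : ℝ) ≤
      (Fintype.card F : ℝ) ^ ((Fintype.card κ : ℝ) * entropy (Fintype.card F) θ) := by
  classical
  set q := Fintype.card F with hq
  set N := Fintype.card κ with hN
  have hq1 : (1 : ℝ) < q := by exact_mod_cast Fintype.one_lt_card
  have hq0 : (0 : ℝ) < q := by linarith
  have hqi : 0 < 1 / (q : ℝ) := by positivity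
  have hθ1 : 0 < 1 - θ := by linarith
  -- Use the product measure in which `0` has probability `1 - θ` and each other symbol has
  -- probability `c`. The bound `θ ≤ 1 - 1/q` says `c ≤ 1 - θ`, so lighter words are likelier and
  -- each word of `W` has probability at least `q ^ (-N h)`.
  set c : ℝ := θ / (q - 1) with hc
  have hc0 : 0 < c := div_pos h0 (by linarith)
  have hcle : c ≤ 1 - θ := by
    rw [hc, div_le_iff₀ (by linarith)]
    have : 1 / (q : ℝ) * q = 1 := by field_simp
    nlinarith
  let p : F → ℝ := fun x => if x = 0 then 1 - θ else c
  have hp0 : ∀ x, 0 < p x := fun x => by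
    simp only [p]; split_ifs <;> assumption
  have hsum : ∑ x, p x = 1 := by
    have hcard : ((Finset.univ.filter fun x : F => ¬ x = 0).card : ℝ) = q - 1 := by
      have : (Finset.univ.filter fun x : F => ¬ x = 0) = Finset.univ.erase 0 := by
        ext; simp
      rw [this, Finset.card_erase_of_mem (Finset.mem_univ _), Finset.card_univ,
        Nat.cast_sub Fintype.card_pos]
      simp [hq]
    have h2 : (Finset.univ.filter fun x : F => x = 0) = {0} := by ext; simp
    simp only [p]
    rw [Finset.sum_ite, Finset.sum_const, Finset.sum_const, nsmul_eq_mul, nsmul_eq_mul, hcard, h2,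
      hc]
    have : (q : ℝ) - 1 ≠ 0 := by linarith
    field_simp
    simp
  have htot : ∑ w : κ → F, ∏ i, p (w i) = 1 := by
    have := Finset.prod_univ_sum (fun _ : κ => (Finset.univ : Finset F)) (fun _ x => p x)
    rw [Fintype.piFinset_univ] at this
    rw [← this]
    simp [hsum]
  have hprod : ∀ w : κ → F,
      ∏ i, p (w i) = (1 - θ) ^ (N - hammingNorm w) * c ^ hammingNorm w := fun w => by
    simp only [p]
    rw [Finset.prod_ite, Finset.prod_const, Finset.prod_const]
    have h3 := Finset.card_filter_add_card_filter_not (s := (Finset.univ : Finset κ))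
      (fun i => w i = 0)
    rw [Finset.card_univ, ← hN] at h3
    have h4 : hammingNorm w = (Finset.univ.filter fun i => ¬ w i = 0).card := rfl
    rw [h4, ← h3, Nat.add_sub_cancel]
  have hlow : ∀ w ∈ W, (q : ℝ) ^ (-((N : ℝ) * entropy q θ)) ≤ ∏ i, p (w i) := fun w hw => by
    have hwt := hW w hw
    have hle : hammingNorm w ≤ N := hammingNorm_le_card_fintype
    rw [hprod w, ← Real.log_le_log_iff (Real.rpow_pos_of_pos hq0 _) (by positivity),
      Real.log_rpow hq0, Real.log_mul (by positivity) (by positivity), Real.log_pow, Real.log_pow,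
      Nat.cast_sub hle]
    have hlq : Real.log q ≠ 0 := (Real.log_pos hq1).ne'
    have hent : entropy q θ * Real.log q = - θ * Real.log c - (1 - θ) * Real.log (1 - θ) := by
      rw [hc, Real.log_div h0.ne' (by linarith)]
      unfold entropy Real.logb
      field_simp
      ring
    have hlog : Real.log c ≤ Real.log (1 - θ) := Real.log_le_log hc0 hcle
    have : -((N : ℝ) * entropy q θ) * Real.log q =
      N * (θ * Real.log c + (1 - θ) * Real.log (1 - θ)) := by
      linear_combination (-(N : ℝ)) * hent
    rw [this]
    nlinarith
  have hfin : (W.card : ℝ) * (q : ℝ) ^ (-((N : ℝ) * entropy q θ)) ≤ 1 := by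
    rw [← htot, ← nsmul_eq_mul, ← Finset.sum_const]
    exact (Finset.sum_le_sum hlow).trans
      (Finset.sum_le_sum_of_subset_of_nonneg (Finset.subset_univ _)
        fun w _ _ => Finset.prod_nonneg fun i _ => (hp0 _).le)
  rw [Real.rpow_neg hq0.le] at hfin
  have hpos : 0 < (q : ℝ) ^ ((N : ℝ) * entropy q θ) := Real.rpow_pos_of_pos hq0 _
  rwa [← div_eq_mul_inv, div_le_one hpos] at hfin

/-! ### Constacyclic shifts modulo `X ^ n - μ`. -/

section Shift

variable {F : Type*} [Field F]

theorem X_pow_modByMonic {n : ℕ} (hn : n ≠ 0) (μ : F) (m : ℕ) :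
    (X ^ m : F[X]) %ₘ (X ^ n - C μ) = C (μ ^ (m / n)) * X ^ (m % n) := by
  have hM : (X ^ n - C μ : F[X]).Monic := monic_X_pow_sub_C μ hn
  have hdvd : (X ^ n - C μ : F[X]) ∣ X ^ m - C (μ ^ (m / n)) * X ^ (m % n) := by
    have h1 : (X ^ m : F[X]) = (X ^ n) ^ (m / n) * X ^ (m % n) := by
      rw [← pow_mul, ← pow_add, Nat.div_add_mod]
    rw [h1, C_pow, ← sub_mul]
    exact (sub_dvd_pow_sub_pow _ _ _).mul_right _
  rw [modByMonic_eq_of_dvd_sub hM hdvd, modByMonic_eq_self_iff hM, degree_X_pow_sub_C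
    (Nat.pos_of_ne_zero hn)]
  refine (degree_C_mul_X_pow_le _ _).trans_lt ?_
  exact_mod_cast Nat.mod_lt _ (Nat.pos_of_ne_zero hn)

theorem coeff_X_pow_mul_modByMonic {n : ℕ} (hn : n ≠ 0) (μ : F) {u : F[X]} (hu : u.degree < n)
    (s : ℕ) {j : ℕ} (hj : j < n) :
    ((X ^ s * u) %ₘ (X ^ n - C μ)).coeff ((j + s) % n) = μ ^ ((j + s) / n) * u.coeff j := by
  have hsum : X ^ s * u = ∑ i ∈ Finset.range n, u.coeff i • (X ^ (i + s) : F[X]) := by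
    have hnat : u.natDegree < n := by
      rcases eq_or_ne u 0 with rfl | h
      · simpa using Nat.pos_of_ne_zero hn
      · exact (natDegree_lt_iff_degree_lt h).2 hu
    conv_lhs => rw [u.as_sum_range_C_mul_X_pow' hnat]
    rw [Finset.mul_sum]
    refine Finset.sum_congr rfl fun i _ => ?_
    rw [smul_eq_C_mul, pow_add]; ring
  have hmod : (X ^ s * u) %ₘ (X ^ n - C μ) =
      ∑ i ∈ Finset.range n, u.coeff i • (C (μ ^ ((i + s) / n)) * X ^ ((i + s) % n) : F[X]) := by
    rw [hsum]
    change modByMonicHom (X ^ n - C μ) _ = _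
    rw [map_sum]
    refine Finset.sum_congr rfl fun i _ => ?_
    rw [map_smul]
    change _ • (X ^ (i + s) %ₘ (X ^ n - C μ)) = _
    rw [X_pow_modByMonic hn]
  rw [hmod, finsetSum_coeff, Finset.sum_eq_single j]
  · rw [coeff_smul, coeff_C_mul, coeff_X_pow, if_pos rfl, mul_one, smul_eq_mul, mul_comm]
  · intro i hi hij
    have hne : (j + s) % n ≠ (i + s) % n := fun h => hij <| by
      have := Nat.ModEq.add_right_cancel' s (show j + s ≡ i + s [MOD n] from h)
      have h2 : j % n = i % n := this
      rw [Nat.mod_eq_of_lt hj, Nat.mod_eq_of_lt (Finset.mem_range.1 hi)] at h2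
      exact h2.symm
    rw [coeff_smul, coeff_C_mul, coeff_X_pow, if_neg hne, mul_zero, smul_zero]
  · intro h
    exact absurd (Finset.mem_range.2 hj) h

/-- Each coordinate of the shifts of a word is nonzero as often as the word has weight. -/
theorem card_shift_coeff_ne_zero [DecidableEq F] {n : ℕ} {μ : F} (hμ : μ ≠ 0) {u : F[X]}
    (hu : u.degree < n) {i : ℕ} (hi : i < n) :
    ((Finset.range n).filter fun s => ((X ^ s * u) %ₘ (X ^ n - C μ)).coeff i ≠ 0).card =
      u.support.card := by
  have hn : n ≠ 0 := by omega
  have key : ∀ s < n, ((X ^ s * u) %ₘ (X ^ n - C μ)).coeff i ≠ 0 ↔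
      u.coeff ((i + (n - s)) % n) ≠ 0 := fun s hs => by
    have h := coeff_X_pow_mul_modByMonic hn μ hu s (Nat.mod_lt (i + (n - s)) (by omega))
    have h2 : ((i + (n - s)) % n + s) % n = i := by
      rw [Nat.mod_add_mod, add_assoc, Nat.sub_add_cancel hs.le, Nat.add_mod_right,
        Nat.mod_eq_of_lt hi]
    rw [h2] at h
    rw [h]
    simp [hμ]
  have hinv : ∀ s < n, (i + (n - (i + (n - s)) % n)) % n = s := fun s hs => by
    rcases lt_or_ge i s with h | h
    · rw [Nat.mod_eq_of_lt (show i + (n - s) < n by omega),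
        show i + (n - (i + (n - s))) = s by omega, Nat.mod_eq_of_lt hs]
    · rw [show i + (n - s) = (i - s) + n by omega, Nat.add_mod_right,
        Nat.mod_eq_of_lt (show i - s < n by omega),
        show i + (n - (i - s)) = s + n by omega, Nat.add_mod_right, Nat.mod_eq_of_lt hs]
  have hsupp : ∀ j ∈ u.support, j < n := fun j hj => by
    have := le_degree_of_mem_supp _ hj
    exact_mod_cast this.trans_lt hu
  -- The map `s ↦ i - s` modulo `n` is its own inverse; it gives the position of `u` that the shift
  -- by `s` moves to `i`.
  refine Finset.card_bij' (fun s _ => (i + (n - s)) % n) (fun j _ => (i + (n - j)) % n) ?_ ?_ ?_ ?_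
  · intro s hs
    simp only [Finset.mem_filter, Finset.mem_range] at hs
    exact mem_support_iff.2 ((key s hs.1).1 hs.2)
  · intro j hj
    have hlt : (i + (n - j)) % n < n := Nat.mod_lt _ (by omega)
    simp only [Finset.mem_filter, Finset.mem_range]
    refine ⟨hlt, (key _ hlt).2 ?_⟩
    rw [hinv j (hsupp j hj)]
    exact mem_support_iff.1 hj
  · intro s hs
    exact hinv s (Finset.mem_range.1 (Finset.mem_filter.1 hs).1)
  · intro j hj
    exact hinv j (hsupp j hj)

theorem isCoprime_X_pow_X_pow_sub_C {n : ℕ} (hn : n ≠ 0) {μ : F} (hμ : μ ≠ 0) (s : ℕ) :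
    IsCoprime (X ^ n - C μ : F[X]) (X ^ s) := by
  apply IsCoprime.pow_right
  rw [isCoprime_comm, Polynomial.irreducible_X.coprime_iff_not_dvd, X_dvd_iff]
  simp [hn.symm, hμ]

/-- The top coordinates of a shift form an information set of a cyclic ideal. -/
theorem eq_zero_of_shift_coeff_eq_zero {n : ℕ} (hn : n ≠ 0) {μ : F} (hμ : μ ≠ 0) {g u : F[X]}
    (hg : g ∣ X ^ n - C μ) (hgu : g ∣ u) (hu : u.degree < n) (s : ℕ)
    (h : ∀ i, g.natDegree ≤ i → i < n → ((X ^ s * u) %ₘ (X ^ n - C μ)).coeff i = 0) : u = 0 := by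
  have hM : (X ^ n - C μ : F[X]).Monic := monic_X_pow_sub_C μ hn
  have hdegM : (X ^ n - C μ : F[X]).degree = n := degree_X_pow_sub_C (Nat.pos_of_ne_zero hn) μ
  set w := (X ^ s * u) %ₘ (X ^ n - C μ) with hw
  have hgw : g ∣ w := by
    have := modByMonic_add_div (X ^ s * u) (X ^ n - C μ)
    rw [← hw] at this
    exact (dvd_add_left (hg.mul_right _)).1 (this ▸ hgu.mul_left _)
  have hg0 : g ≠ 0 := fun h0 => hM.ne_zero (zero_dvd_iff.1 (h0 ▸ hg))
  -- A multiple of `g` whose coefficients vanish from degree `deg g` on is zero; then `X ^ s`, a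
  -- unit modulo `X ^ n - μ`, can be cancelled.
  have hw0 : w = 0 := by
    refine eq_zero_of_dvd_of_degree_lt hgw ?_
    rw [degree_eq_natDegree hg0, degree_lt_iff_coeff_zero]
    intro i hi
    by_cases hin : i < n
    · exact h i hi hin
    · refine coeff_eq_zero_of_degree_lt ((degree_modByMonic_lt _ hM).trans_le ?_)
      rw [hdegM]; exact_mod_cast not_lt.1 hin
  rw [hw, modByMonic_eq_zero_iff_dvd hM] at hw0
  have := (isCoprime_X_pow_X_pow_sub_C hn hμ s).dvd_of_dvd_mul_left hw0
  exact eq_zero_of_dvd_of_degree_lt this (by rwa [hdegM])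

end Shift

/-! ### Low-weight pairs in the square of an ideal. -/

section Words

variable (F : Type*) [Field F] [Fintype F]

theorem finite_degree_lt (n : ℕ) : {p : F[X] | p.degree < n}.Finite := by
  have : Finite (degreeLT F n) := Finite.of_equiv _ (degreeLTEquiv F n).toEquiv.symm
  have h2 : {p : F[X] | p.degree < n} = (degreeLT F n : Set F[X]) := by
    ext p; simp [mem_degreeLT]
  rw [h2]
  exact Set.toFinite _

/-- The polynomials of degree less than `n`. -/
noncomputable def polysLT (n : ℕ) : Finset F[X] := (finite_degree_lt F n).toFinset

variable {F} in
@[simp] theorem mem_polysLT {n : ℕ} {p : F[X]} : p ∈ polysLT F n ↔ p.degree < n := by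
  simp [polysLT]

theorem card_polysLT (n : ℕ) : (polysLT F n).card = Fintype.card F ^ n := by
  have h := Nat.card_congr (degreeLTEquiv F n).toEquiv
  rw [Nat.card_fun, Nat.card_fin, Nat.card_eq_fintype_card (α := F)] at h
  rw [← h, ← Set.ncard_coe_finset, ← Nat.card_coe_set_eq]
  refine congrArg (fun s : Set F[X] => Nat.card s) (?_ : _ = (degreeLT F n : Set F[X]))
  ext p
  simp [mem_degreeLT]

variable {F}

open Classical in
/-- The low-weight pairs in the square of the cyclic ideal generated by `g`. -/
noncomputable def lowPairs (n : ℕ) (g : F[X]) (B : ℝ) : Finset (F[X] × F[X]) :=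
  (polysLT F n ×ˢ polysLT F n).filter fun p =>
    g ∣ p.1 ∧ g ∣ p.2 ∧ (p.1.support.card : ℝ) + p.2.support.card ≤ B

/-- Averaged over the `n` shifts, the window formed by the top `n - deg g` coordinates of both
components has the relative weight of the whole pair. So some shift has a window of relative weight
at most `θ`. That window determines the pair, and the entropy bound counts the windows; the factor
`n` pays for the choice of shift. -/
theorem card_lowPairs_le {n : ℕ} (hn : n ≠ 0) {μ : F} (hμ : μ ≠ 0) {g : F[X]}
    (hg : g ∣ X ^ n - C μ) {θ : ℝ} (h0 : 0 < θ) (h1 : θ ≤ 1 - 1 / (Fintype.card F : ℝ)) :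
    ((lowPairs n g (2 * θ * n)).card : ℝ) ≤
      n * (Fintype.card F : ℝ) ^ (2 * ((n - g.natDegree : ℕ) : ℝ) * entropy (Fintype.card F) θ) := by
  classical
  set d := g.natDegree with hd
  set k := n - d with hk
  have hM : (X ^ n - C μ : F[X]).Monic := monic_X_pow_sub_C μ hn
  have hdn : d ≤ n := by
    have := natDegree_le_of_dvd hg hM.ne_zero
    rwa [natDegree_X_pow_sub_C] at this
  let win : ℕ → F[X] × F[X] → (Bool × Fin k → F) := fun s p x =>
    ((X ^ s * (if x.1 then p.1 else p.2)) %ₘ (X ^ n - C μ)).coeff (d + x.2)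
  let A : ℕ → Finset (F[X] × F[X]) := fun s =>
    (lowPairs n g (2 * θ * n)).filter fun p =>
      (hammingNorm (win s p) : ℝ) ≤ θ * Fintype.card (Bool × Fin k)
  have hcard : (Fintype.card (Bool × Fin k) : ℝ) = 2 * k := by simp
  have hmem : ∀ p ∈ lowPairs n g (2 * θ * n), p.1.degree < n ∧ p.2.degree < n ∧ g ∣ p.1 ∧ g ∣ p.2 ∧
      (p.1.support.card : ℝ) + p.2.support.card ≤ 2 * θ * n := fun p hp => by
    simpa [lowPairs, and_assoc] using hp
  have hA : ∀ s, ((A s).card : ℝ) ≤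
      (Fintype.card F : ℝ) ^ (2 * (k : ℝ) * entropy (Fintype.card F) θ) := fun s => by
    rw [← hcard]
    have hinj : Set.InjOn (win s) (A s) := by
      intro p hp p' hp' he
      obtain ⟨hp1, hp2, hp3, hp4, -⟩ := hmem p (Finset.mem_filter.1 hp).1
      obtain ⟨hq1, hq2, hq3, hq4, -⟩ := hmem p' (Finset.mem_filter.1 hp').1
      have aux : ∀ b : Bool, (if b then p.1 else p.2) - (if b then p'.1 else p'.2) = 0 := fun b => by
        refine eq_zero_of_shift_coeff_eq_zero hn hμ hg ?_ ?_ s ?_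
        · cases b
          · simpa using dvd_sub hp4 hq4
          · simpa using dvd_sub hp3 hq3
        · refine (degree_sub_le _ _).trans_lt ?_
          cases b <;> simp [*]
        · intro i hi hin
          have := congrFun he (b, ⟨i - d, by omega⟩)
          simp only [win, show d + (i - d) = i by omega] at this
          rw [mul_sub, sub_modByMonic, coeff_sub, this, sub_self]
      have e1 := aux true
      have e2 := aux false
      simp only [if_true, sub_eq_zero] at e1
      simp [sub_eq_zero] at e2
      exact Prod.ext e1 e2
    rw [← Finset.card_image_of_injOn hinj]
    refine card_le_of_hammingNorm_le h0 h1 _ ?_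
    intro w hw
    obtain ⟨p, hp, rfl⟩ := Finset.mem_image.1 hw
    exact (Finset.mem_filter.1 hp).2
  have hcover : lowPairs n g (2 * θ * n) ⊆ (Finset.range n).biUnion A := by
    intro p hp
    obtain ⟨hp1, hp2, -, -, hwt⟩ := hmem p hp
    by_contra hcon
    have hbig : ∀ s ∈ Finset.range n, 2 * θ * k < (hammingNorm (win s p) : ℝ) := fun s hs => by
      by_contra hle
      refine hcon (Finset.mem_biUnion.2 ⟨s, hs, Finset.mem_filter.2 ⟨hp, ?_⟩⟩)
      rw [hcard]; linarith
    have hsum : ∑ s ∈ Finset.range n, hammingNorm (win s p) =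
        k * (p.1.support.card + p.2.support.card) := by
      unfold hammingNorm
      simp_rw [Finset.card_filter]
      rw [Finset.sum_comm]
      simp_rw [← Finset.card_filter]
      rw [Fintype.sum_prod_type, Fintype.sum_bool]
      have hb : ∀ (b : Bool) (i : Fin k),
          ((Finset.range n).filter fun s => win s p (b, i) ≠ 0).card =
            (if b then p.1 else p.2).support.card := fun b i => by
        refine card_shift_coeff_ne_zero hμ ?_ (by omega)
        cases b <;> simp [*]
      simp_rw [hb]
      simp
      ring
    have hlt := Finset.sum_lt_sum_of_nonempty (Finset.nonempty_range_iff.2 hn) hbig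
    have hsum' : ∑ s ∈ Finset.range n, (hammingNorm (win s p) : ℝ) =
        k * (p.1.support.card + p.2.support.card) := by exact_mod_cast hsum
    rw [hsum', Finset.sum_const, Finset.card_range, nsmul_eq_mul] at hlt
    have : (k : ℝ) * (p.1.support.card + p.2.support.card) ≤ k * (2 * θ * n) := by gcongr
    linarith
  calc ((lowPairs n g (2 * θ * n)).card : ℝ)
      ≤ (((Finset.range n).biUnion A).card : ℝ) := by exact_mod_cast Finset.card_le_card hcover
    _ ≤ ∑ s ∈ Finset.range n, ((A s).card : ℝ) := by exact_mod_cast Finset.card_biUnion_le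
    _ ≤ ∑ s ∈ Finset.range n, _ := Finset.sum_le_sum fun s _ => hA s
    _ = _ := by rw [Finset.sum_const, Finset.card_range, nsmul_eq_mul]

end Words

theorem exists_monic_gcd {F : Type*} [Field F] (u : F[X]) {M : F[X]} (hM : M ≠ 0) :
    ∃ g x y : F[X], g.Monic ∧ g ∣ u ∧ g ∣ M ∧ x * u + y * M = g := by
  classical
  set g := EuclideanDomain.gcd u M with hg
  have hg0 : g ≠ 0 := fun h => hM (EuclideanDomain.gcd_eq_zero_iff.1 h).2
  have hu : IsUnit (C g.leadingCoeff⁻¹) :=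
    isUnit_C.2 (isUnit_iff_ne_zero.2 (inv_ne_zero (leadingCoeff_ne_zero.2 hg0)))
  refine ⟨g * C g.leadingCoeff⁻¹, EuclideanDomain.gcdA u M * C g.leadingCoeff⁻¹,
    EuclideanDomain.gcdB u M * C g.leadingCoeff⁻¹, monic_mul_leadingCoeff_inv hg0,
    hu.mul_right_dvd.2 (EuclideanDomain.gcd_dvd_left u M),
    hu.mul_right_dvd.2 (EuclideanDomain.gcd_dvd_right u M), ?_⟩
  have := EuclideanDomain.gcd_eq_gcd_ab u M
  rw [← hg] at this
  linear_combination (-C g.leadingCoeff⁻¹) * this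

/-! ### Counting bad multipliers. -/

section Counting

variable {F : Type*} [Field F] [Fintype F]

open Classical in
/-- A product modulo `M` determines the factor `b` up to a multiple of `M / gcd(u, M)`. -/
theorem card_mul_modByMonic_eq_le {n : ℕ} {M g u x y : F[X]} (hM : M.Monic)
    (hMn : M.natDegree = n) (hg : g.Monic) (hgM : g ∣ M) (hgcd : x * u + y * M = g) (v : F[X]) :
    ((polysLT F n).filter fun b => (u * b) %ₘ M = v).card ≤ Fintype.card F ^ g.natDegree := by
  obtain ⟨m, rfl⟩ := hgM
  have hm : m.Monic := hg.of_mul_monic_left hM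
  have hdeg : n = g.natDegree + m.natDegree := by rw [← hMn, hg.natDegree_mul hm]
  rw [← card_polysLT]
  -- Multipliers with the same product agree modulo `m = M / g`, so they are told apart by their
  -- quotients by `m`, which have degree below `deg g`.
  refine Finset.card_le_card_of_injOn (fun b => b /ₘ m) ?_ ?_
  · intro b hb
    have hb' : b.degree < n := by simpa using (Finset.mem_filter.1 hb).1
    simp only [Finset.mem_coe, mem_polysLT]
    by_cases hlt : b.degree < m.degree
    · rw [(divByMonic_eq_zero_iff hm).2 hlt, degree_zero]
      exact WithBot.bot_lt_coe _
    · have hb0 : b ≠ 0 := fun h => hlt (by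
        rw [h, degree_zero]; exact bot_lt_iff_ne_bot.2 (degree_ne_bot.2 hm.ne_zero))
      have h1 : m.natDegree ≤ b.natDegree := natDegree_le_natDegree (not_lt.1 hlt)
      have h2 := (natDegree_lt_iff_degree_lt hb0).2 hb'
      refine degree_le_natDegree.trans_lt ?_
      rw [natDegree_divByMonic b hm]
      exact_mod_cast (by omega : b.natDegree - m.natDegree < g.natDegree)
  · intro b hb b' hb' he
    have e1 := (Finset.mem_filter.1 hb).2
    have e2 := (Finset.mem_filter.1 hb').2
    have h1 : g * m ∣ u * (b - b') := by
      rw [← modByMonic_eq_zero_iff_dvd hM, mul_sub, sub_modByMonic, e1, e2, sub_self]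
    have h2 : g * m ∣ g * (b - b') := by
      have h3 : g * (b - b') = x * (u * (b - b')) + g * m * (y * (b - b')) := by
        linear_combination (-(b - b')) * hgcd
      rw [h3]
      exact dvd_add (h1.mul_left _) (dvd_mul_right _ _)
    have h3 : m ∣ b - b' := (mul_dvd_mul_iff_left hg.ne_zero).1 h2
    have h4 : b %ₘ m = b' %ₘ m := by
      rw [← sub_eq_zero, ← sub_modByMonic, modByMonic_eq_zero_iff_dvd hm]; exact h3
    rw [← modByMonic_add_div b m, ← modByMonic_add_div b' m, h4]
    simp only at he
    rw [he]

/-- A Gilbert–Varshamov argument: if there are few ideals between `e` and `M` and all of them are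
large, some multiplier `b` gives a code of relative distance larger than `θ`. -/
theorem exists_multiplier {n : ℕ} (hn : n ≠ 0) {μ : F} (hμ : μ ≠ 0) {e : F[X]}
    (he : e ∣ X ^ n - C μ) {θ : ℝ} (h0 : 0 < θ) (h1 : θ ≤ 1 - 1 / (Fintype.card F : ℝ))
    (hent : entropy (Fintype.card F) θ ≤ 1 / 2) {d : ℕ} (G : Finset F[X])
    (hG : ∀ g : F[X], g.Monic → e ∣ g → g ∣ X ^ n - C μ → g ≠ X ^ n - C μ → g ∈ G)
    (hGM : ∀ g ∈ G, g ∣ X ^ n - C μ) (hd : ∀ g ∈ G, d + g.natDegree ≤ n)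
    (hcount : (G.card : ℝ) * n *
      (Fintype.card F : ℝ) ^ (-(1 - 2 * entropy (Fintype.card F) θ) * d) < 1) :
    ∃ b : F[X], ∀ u : F[X], u.degree < n → u ≠ 0 → e ∣ u →
      2 * θ * n < (u.support.card : ℝ) + ((u * b) %ₘ (X ^ n - C μ)).support.card := by
  classical
  by_contra hcon
  push Not at hcon
  set q := Fintype.card F with hq
  set h := entropy q θ with hh
  have hq1 : (1 : ℝ) < q := by exact_mod_cast Fintype.one_lt_card
  have hq0 : (0 : ℝ) < q := by linarith
  have hM : (X ^ n - C μ : F[X]).Monic := monic_X_pow_sub_C μ hn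
  have hMdeg : (X ^ n - C μ : F[X]).degree = n := degree_X_pow_sub_C (Nat.pos_of_ne_zero hn) μ
  have hMnat : (X ^ n - C μ : F[X]).natDegree = n := natDegree_X_pow_sub_C
  let fib : F[X] × F[X] → Finset F[X] := fun p =>
    (polysLT F n).filter fun b => (p.1 * b) %ₘ (X ^ n - C μ) = p.2
  let good : F[X] → Finset (F[X] × F[X]) := fun g =>
    (lowPairs n g (2 * θ * n)).filter fun p => ((fib p).card : ℝ) ≤ (q : ℝ) ^ g.natDegree
  -- If no multiplier works, each `b` has a light pair `(u, u b mod M)`, where `M = X ^ n - μ`. For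
  -- `g = gcd(u, M)` both entries lie in the ideal of `g`, and `g ≠ M` because `u` is nonzero of
  -- degree below `n`.
  have hcover : polysLT F n ⊆ G.biUnion fun g => (good g).biUnion fib := by
    intro b hb
    obtain ⟨u, hu, hu0, heu, hwt⟩ := hcon b
    obtain ⟨g, x, y, hgm, hgu, hgM, hgcd⟩ := exists_monic_gcd u hM.ne_zero
    have heg : e ∣ g := hgcd ▸ dvd_add (heu.mul_left _) (he.mul_left _)
    have hgne : g ≠ X ^ n - C μ := fun h =>
      hu0 (eq_zero_of_dvd_of_degree_lt (h ▸ hgu) (by rwa [hMdeg]))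
    have hgv : g ∣ (u * b) %ₘ (X ^ n - C μ) := by
      have := modByMonic_add_div (u * b) (X ^ n - C μ)
      exact (dvd_add_left (hgM.mul_right _)).1 (this ▸ hgu.mul_right _)
    refine Finset.mem_biUnion.2 ⟨g, hG g hgm heg hgM hgne, Finset.mem_biUnion.2
      ⟨(u, (u * b) %ₘ (X ^ n - C μ)), Finset.mem_filter.2 ⟨Finset.mem_filter.2 ⟨?_, hgu, hgv, hwt⟩,
        ?_⟩, Finset.mem_filter.2 ⟨hb, rfl⟩⟩⟩
    · refine Finset.mk_mem_product (mem_polysLT.2 hu) (mem_polysLT.2 ?_)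
      exact (degree_modByMonic_lt _ hM).trans_eq hMdeg
    · exact_mod_cast card_mul_modByMonic_eq_le hM hMnat hgm hgM hgcd _
  have hone : ∀ g ∈ G, ((((good g).biUnion fib).card : ℕ) : ℝ) ≤
      (q : ℝ) ^ (n : ℝ) * (n * (q : ℝ) ^ (-(1 - 2 * h) * d)) := fun g hg => by
    have hdg := hd g hg
    calc ((((good g).biUnion fib).card : ℕ) : ℝ)
        ≤ ∑ p ∈ good g, ((fib p).card : ℝ) := by exact_mod_cast Finset.card_biUnion_le
      _ ≤ ∑ p ∈ good g, (q : ℝ) ^ g.natDegree :=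
          Finset.sum_le_sum fun p hp => (Finset.mem_filter.1 hp).2
      _ = (good g).card * (q : ℝ) ^ g.natDegree := by rw [Finset.sum_const, nsmul_eq_mul]
      _ ≤ (n * (q : ℝ) ^ (2 * ((n - g.natDegree : ℕ) : ℝ) * h)) * (q : ℝ) ^ g.natDegree := by
          gcongr
          refine le_trans ?_ (card_lowPairs_le hn hμ (hGM g hg) h0 h1)
          exact_mod_cast Finset.card_le_card (Finset.filter_subset _ _)
      _ = n * (q : ℝ) ^ (2 * ((n - g.natDegree : ℕ) : ℝ) * h + g.natDegree) := by
          rw [Real.rpow_add hq0, Real.rpow_natCast, mul_assoc]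
      -- The exponent on the left is `n - (1 - 2 h) (n - deg g)`, where `1 - 2 h ≥ 0` and `n - deg g
      -- ≥ d`.
      _ ≤ n * (q : ℝ) ^ ((n : ℝ) + -(1 - 2 * h) * d) := by
          refine mul_le_mul_of_nonneg_left (Real.rpow_le_rpow_of_exponent_le hq1.le ?_)
            (Nat.cast_nonneg n)
          · have h3 : ((n - g.natDegree : ℕ) : ℝ) = n - g.natDegree :=
              Nat.cast_sub (by omega)
            have h4 : (d : ℝ) + g.natDegree ≤ n := by exact_mod_cast hdg
            rw [h3]
            nlinarith
      _ = _ := by rw [Real.rpow_add hq0]; ring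
  have htot : ((polysLT F n).card : ℝ) ≤
      G.card * ((q : ℝ) ^ (n : ℝ) * (n * (q : ℝ) ^ (-(1 - 2 * h) * d))) := by
    calc ((polysLT F n).card : ℝ)
        ≤ ((G.biUnion fun g => (good g).biUnion fib).card : ℝ) := by
          exact_mod_cast Finset.card_le_card hcover
      _ ≤ ∑ g ∈ G, ((((good g).biUnion fib).card : ℕ) : ℝ) := by
          exact_mod_cast Finset.card_biUnion_le
      _ ≤ ∑ g ∈ G, _ := Finset.sum_le_sum hone
      _ = _ := by rw [Finset.sum_const, nsmul_eq_mul]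
  rw [card_polysLT, Nat.cast_pow, ← hq, ← Real.rpow_natCast] at htot
  have hpos : 0 < (q : ℝ) ^ (n : ℝ) := Real.rpow_pos_of_pos hq0 _
  nlinarith [mul_lt_mul_of_pos_left hcount hpos]

end Counting

/-! ### Ideals between `e` and `e Φ`. -/

section Divisors

variable {F : Type*} [Field F]

open UniqueFactorizationMonoid in
/-- If all irreducible factors of `Φ` have degree at least `d`, then the proper divisors of `e Φ`
that are multiples of `e` are few and have codegree at least `d`. -/
theorem exists_finset_divisors {e Φ : F[X]} (he : e.Monic) (hΦ : Φ.Monic) {d m : ℕ}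
    (hd : ∀ p, Irreducible p → p ∣ Φ → d ≤ p.natDegree)
    (hm : ∀ j, j * d ≤ Φ.natDegree → j ≤ m) :
    ∃ G : Finset F[X], G.card ≤ 2 ^ m ∧
      (∀ g : F[X], g.Monic → e ∣ g → g ∣ e * Φ → g ≠ e * Φ → g ∈ G) ∧
      (∀ g ∈ G, g ∣ e * Φ) ∧ ∀ g ∈ G, d + g.natDegree ≤ (e * Φ).natDegree := by
  classical
  let G₀ := (normalizedFactors Φ).powerset.toFinset.image fun s => e * s.prod
  refine ⟨G₀.filter fun g => g.Monic ∧ e ∣ g ∧ g ∣ e * Φ ∧ g ≠ e * Φ, ?_, ?_, ?_, ?_⟩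
  · have h1 : (normalizedFactors Φ).card ≤ m := by
      refine hm _ ?_
      have hprod : (normalizedFactors Φ).prod = Φ := by
        rw [prod_normalizedFactors_eq hΦ.ne_zero, hΦ.normalize_eq_self]
      conv_rhs => rw [← hprod]
      rw [natDegree_multiset_prod _ (zero_notMem_normalizedFactors Φ), ← smul_eq_mul,
        ← Multiset.card_map natDegree]
      refine Multiset.card_nsmul_le_sum fun k hk => ?_
      obtain ⟨p, hp, rfl⟩ := Multiset.mem_map.1 hk
      exact hd p (irreducible_of_normalized_factor p hp) (dvd_of_mem_normalizedFactors hp)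
    calc _ ≤ G₀.card := Finset.card_filter_le _ _
      _ ≤ (normalizedFactors Φ).powerset.toFinset.card := Finset.card_image_le
      _ ≤ (normalizedFactors Φ).powerset.card := Multiset.toFinset_card_le _
      _ = 2 ^ (normalizedFactors Φ).card := Multiset.card_powerset _
      _ ≤ 2 ^ m := Nat.pow_le_pow_right (by norm_num) h1
  · intro g hg heg hgM hne
    refine Finset.mem_filter.2 ⟨?_, hg, heg, hgM, hne⟩
    obtain ⟨g', rfl⟩ := heg
    have hg' : g'.Monic := he.of_mul_monic_left hg
    have hdvd : g' ∣ Φ := (mul_dvd_mul_iff_left he.ne_zero).1 hgM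
    refine Finset.mem_image.2 ⟨normalizedFactors g', ?_, ?_⟩
    · rw [Multiset.mem_toFinset, Multiset.mem_powerset]
      exact (dvd_iff_normalizedFactors_le_normalizedFactors hg'.ne_zero hΦ.ne_zero).1 hdvd
    · simp only [prod_normalizedFactors_eq hg'.ne_zero, hg'.normalize_eq_self]
  · intro g hg
    exact (Finset.mem_filter.1 hg).2.2.2.1
  · intro g hg
    obtain ⟨-, hg, ⟨g', rfl⟩, ⟨k, hk⟩, hne⟩ := Finset.mem_filter.1 hg
    -- The codegree of `g` is the degree of the complementary factor `k`, a nonunit divisor of `Φ`,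
    -- which therefore contains a whole irreducible factor of `Φ`.
    have hkm : k.Monic := hg.of_mul_monic_left (hk ▸ he.mul hΦ)
    have hkΦ : k ∣ Φ := ⟨g', mul_left_cancel₀ he.ne_zero (by rw [hk]; ring)⟩
    have hku : ¬ IsUnit k := fun hu => hne (by rw [hk, hkm.eq_one_of_isUnit hu, mul_one])
    obtain ⟨p, hp, hpk⟩ := WfDvdMonoid.exists_irreducible_factor hku hkm.ne_zero
    have h1 := hd p hp (hpk.trans hkΦ)
    have h2 := natDegree_le_of_dvd hpk hkm.ne_zero
    rw [hk, hg.natDegree_mul hkm]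
    omega

end Divisors

/-! ### Degrees of the irreducible factors of `Φ`. -/

section IrreducibleFactors

/-- For a root `ρ` of `p`, the element `z = ρ / β` satisfies `z ^ (r ^ k) = 1`. If also `z ^ (r ^ l)
= 1`, the geometric sum `Φ(ρ)` would be `r ^ (k - l)` times a nonzero element, hence nonzero in
`F[X]/⟨p⟩`. So `z` has order `r ^ j` with `j > l`, and this order divides that of the unit group of
`F[X]/⟨p⟩`. -/
theorem dvd_card_pow_natDegree_sub_one {F : Type*} [Field F] [Fintype F] {r l k : ℕ}
    (hr : r.Prime) (hrF : (r : F) ≠ 0) (hlk : l ≤ k) {β : F} (hβ : β ≠ 0) {Φ p : F[X]}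
    (hΦ : (X ^ r ^ l - C (β ^ r ^ l)) * Φ = X ^ r ^ k - C (β ^ r ^ k))
    (hp : Irreducible p) (hpΦ : p ∣ Φ) : r ^ (l + 1) ∣ Fintype.card F ^ p.natDegree - 1 := by
  have : Fact (Irreducible p) := ⟨hp⟩
  set f := AdjoinRoot.of p with hf
  set ρ := AdjoinRoot.root p with hρ
  set m := r ^ (k - l) with hm
  have hkm : r ^ k = r ^ l * m := by rw [hm, ← pow_add]; congr 1; omega
  have hΦ' : Φ = ∑ i ∈ Finset.range m, (X ^ r ^ l) ^ i * (C (β ^ r ^ l)) ^ (m - 1 - i) := by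
    refine mul_left_cancel₀ (X_pow_sub_C_ne_zero (pow_pos hr.pos l) (β ^ r ^ l)) ?_
    rw [hΦ, mul_comm, geom_sum₂_mul, hkm, pow_mul, pow_mul, ← C_pow]
  have hroot : Φ.eval₂ f ρ = 0 := by
    obtain ⟨c, rfl⟩ := hpΦ
    rw [eval₂_mul, AdjoinRoot.eval₂_root, zero_mul]
  have hfβ : f β ≠ 0 := (map_ne_zero f).2 hβ
  have hne : ρ ^ r ^ l ≠ f β ^ r ^ l := fun h => by
    rw [hΦ', eval₂_finsetSum] at hroot
    have : ∀ i ∈ Finset.range m,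
        eval₂ f ρ ((X ^ r ^ l) ^ i * (C (β ^ r ^ l)) ^ (m - 1 - i)) =
          (f β ^ r ^ l) ^ (m - 1) := fun i hi => by
      rw [eval₂_mul, eval₂_pow, eval₂_pow, eval₂_pow, eval₂_X, eval₂_C, map_pow, h, ← pow_add]
      congr 1
      have := Finset.mem_range.1 hi
      omega
    rw [Finset.sum_congr rfl this, Finset.sum_const, Finset.card_range, nsmul_eq_mul] at hroot
    refine mul_ne_zero ?_ (pow_ne_zero _ (pow_ne_zero _ hfβ)) hroot
    rw [hm, Nat.cast_pow]
    refine pow_ne_zero _ ?_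
    rw [← map_natCast f]
    exact (map_ne_zero f).2 hrF
  have heq : ρ ^ r ^ k = f β ^ r ^ k := by
    have h := congrArg (eval₂ f ρ) hΦ
    rw [eval₂_mul, hroot, mul_zero, eval₂_sub, eval₂_pow, eval₂_X, eval₂_C, map_pow] at h
    exact (sub_eq_zero.1 h.symm)
  set z := ρ / f β with hz
  have hz1 : z ^ r ^ k = 1 := by rw [hz, div_pow, heq, div_self (pow_ne_zero _ hfβ)]
  have hz2 : z ^ r ^ l ≠ 1 := by
    rw [hz, div_pow, ne_eq, div_eq_one_iff_eq (pow_ne_zero _ hfβ)]; exact hne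
  have hz0 : z ≠ 0 := fun h => by
    rw [h, zero_pow (pow_pos hr.pos _).ne'] at hz1; exact zero_ne_one hz1
  obtain ⟨j, -, hj⟩ := (Nat.dvd_prime_pow hr).1 (orderOf_dvd_of_pow_eq_one hz1)
  have hlj : l < j := by
    by_contra hle
    exact hz2 (orderOf_dvd_iff_pow_eq_one.1 (hj ▸ pow_dvd_pow r (not_lt.1 hle)))
  have hfin : Module.Finite F (AdjoinRoot p) := (AdjoinRoot.powerBasis hp.ne_zero).finite
  have hfin' : Finite (AdjoinRoot p) := Module.finite_of_finite F
  have hcard : Nat.card (AdjoinRoot p) = Fintype.card F ^ p.natDegree := by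
    rw [Module.natCard_eq_pow_finrank (K := F), Nat.card_eq_fintype_card,
      (AdjoinRoot.powerBasis hp.ne_zero).finrank, AdjoinRoot.powerBasis_dim]
  let _ := Fintype.ofFinite (AdjoinRoot p)
  have hord := orderOf_dvd_of_pow_eq_one (FiniteField.pow_card_sub_one_eq_one z hz0)
  rw [← Nat.card_eq_fintype_card, hcard, hj] at hord
  exact (pow_dvd_pow r hlj).trans hord

/-- Lifting the exponent: `x = q ^ (r - 1)` is `1` modulo `r`, so `v_r(x ^ D - 1) = v_r(x - 1) +
v_r(D)`, and `r ^ v_r(D) ≤ D`. The constant `A = r ^ v_r(x - 1)` depends on neither `l` nor `D`. -/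
theorem exists_le_mul_of_dvd_pow_sub_one {r q : ℕ} (hr : r.Prime) (hodd : Odd r) (hq : 1 < q)
    (hrq : Nat.Coprime q r) :
    ∃ A, 0 < A ∧ ∀ l D : ℕ, D ≠ 0 → r ^ l ∣ q ^ D - 1 → r ^ l ≤ A * D := by
  have : Fact r.Prime := ⟨hr⟩
  have hr1 := hr.two_le
  set x := q ^ (r - 1) with hx
  have hx1 : 1 < x := Nat.one_lt_pow (by omega) hq
  have hrx : ¬ r ∣ x := fun h =>
    hr.one_lt.ne' (Nat.Coprime.eq_one_of_dvd (hrq.symm) (hr.dvd_of_dvd_pow h))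
  have hrx1 : r ∣ x - 1 := by
    have h := Nat.ModEq.pow_totient hrq
    rw [Nat.totient_prime hr] at h
    exact (Nat.modEq_iff_dvd' hx1.le).1 h.symm
  refine ⟨r ^ padicValNat r (x - 1), pow_pos hr.pos _, fun l D hD hdvd => ?_⟩
  have h1 : q ^ D - 1 ∣ x ^ D - 1 := by
    rw [hx, ← pow_mul, mul_comm, pow_mul]
    simpa using Nat.sub_dvd_pow_sub_pow (q ^ D) 1 (r - 1)
  have hne : x ^ D - 1 ≠ 0 := Nat.sub_ne_zero_of_lt (Nat.one_lt_pow hD hx1)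
  have h2 := (padicValNat_dvd_iff_le hne).1 (hdvd.trans h1)
  have h3 := padicValNat.pow_sub_pow hodd hx1 hrx1 hrx hD
  rw [one_pow] at h3
  calc r ^ l ≤ r ^ (padicValNat r (x - 1) + padicValNat r D) :=
        Nat.pow_le_pow_right hr.pos (h3 ▸ h2)
    _ = r ^ padicValNat r (x - 1) * r ^ padicValNat r D := pow_add _ _ _
    _ ≤ _ := Nat.mul_le_mul_left _ (Nat.le_of_dvd (Nat.pos_of_ne_zero hD) pow_padicValNat_dvd)

end IrreducibleFactors

/-! ### Choice of parameters. -/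

/-- Here `y` stands for `r ^ s`: `2 ^ (A y)` bounds the number of ideals and `y ^ 3` is the cycle
length. As `d` is at least `y ^ 2 / A`, the last factor decays exponentially in `y ^ 2` and wins. -/
theorem exists_forall_growth_lt_one {q ε : ℝ} (hq : 1 < q) (hε : 0 < ε) {A : ℕ} (hA : 0 < A) :
    ∃ Y : ℕ, ∀ y d : ℕ, Y ≤ y → y ^ 2 ≤ A * d →
      (2 : ℝ) ^ (A * y) * (y : ℝ) ^ 3 * q ^ (-ε * d) < 1 := by
  have hq0 : 0 < q := by linarith
  have hA' : (0 : ℝ) < A := by exact_mod_cast hA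
  set ρ := q ^ (ε / A) with hρ
  have hρ1 : 1 < ρ := Real.one_lt_rpow hq (div_pos hε hA')
  obtain ⟨Y, hY⟩ := pow_unbounded_of_one_lt ((2 : ℝ) ^ (A + 3)) hρ1
  refine ⟨Y + 1, fun y d hy hd => ?_⟩
  have h1 : (y : ℝ) ≤ 2 ^ y := by exact_mod_cast (Nat.lt_two_pow_self).le
  have h2 : (2 : ℝ) ^ (A * y) * (y : ℝ) ^ 3 ≤ ((2 : ℝ) ^ (A + 3)) ^ y := by
    calc (2 : ℝ) ^ (A * y) * (y : ℝ) ^ 3 ≤ 2 ^ (A * y) * (2 ^ y) ^ 3 := by gcongr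
      _ = _ := by rw [pow_add, mul_pow, ← pow_mul, ← pow_mul, ← pow_mul, mul_comm y 3]
  have h3 : ((2 : ℝ) ^ (A + 3)) ^ y < (ρ ^ y) ^ y :=
    pow_lt_pow_left₀ (hY.trans_le (pow_le_pow_right₀ hρ1.le (by omega))) (by positivity) (by omega)
  have h4 : (ρ ^ y) ^ y ≤ q ^ (ε * d) := by
    rw [← pow_mul, hρ, ← Real.rpow_natCast, ← Real.rpow_mul hq0.le]
    refine Real.rpow_le_rpow_of_exponent_le hq.le ?_
    have h5 : (y : ℝ) * y ≤ A * d := by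
      rw [← sq]; exact_mod_cast hd
    rw [div_mul_eq_mul_div, div_le_iff₀ hA']
    push_cast
    nlinarith
  have hpos : 0 < q ^ (ε * d) := Real.rpow_pos_of_pos hq0 _
  rw [neg_mul, Real.rpow_neg hq0.le, ← div_eq_mul_inv, div_lt_one hpos]
  linarith

/-- Along the cycle lengths `r ^ (3 s)` there are good multipliers for the cyclic ideal generated
by `X ^ (r ^ (2 s)) - β ^ (r ^ (2 s))`. -/
theorem exists_good_multipliers {F : Type*} [Field F] [Fintype F] (N : ℕ) {θ : ℝ} (h0 : 0 < θ)
    (h1 : θ ≤ 1 - 1 / (Fintype.card F : ℝ)) (hent : entropy (Fintype.card F) θ < 1 / 2) :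
    ∃ r s₀ : ℕ, N < r ∧ r.Prime ∧ ∀ s, s₀ ≤ s → ∀ β : F, β ≠ 0 →
      ∃ e Φ : F[X], e.Monic ∧ Φ.Monic ∧ e * Φ = X ^ r ^ (3 * s) - C (β ^ r ^ (3 * s)) ∧
        e.natDegree = r ^ (2 * s) ∧
        ∃ b : F[X], ∀ u : F[X], u.degree < (r ^ (3 * s) : ℕ) → u ≠ 0 → e ∣ u →
          2 * θ * (r ^ (3 * s) : ℕ) < (u.support.card : ℝ) +
            ((u * b) %ₘ (X ^ r ^ (3 * s) - C (β ^ r ^ (3 * s)))).support.card := by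
  set q := Fintype.card F with hq
  have hq1 : 1 < q := Fintype.one_lt_card
  -- The size of `r` makes it odd, as lifting the exponent requires, and coprime to `q`.
  obtain ⟨r, hrN, hr⟩ := Nat.exists_infinite_primes (N + q + 3)
  have hrq : Nat.Coprime q r :=
    ((hr.coprime_iff_not_dvd).2 fun h => by have := Nat.le_of_dvd (by omega) h; omega).symm
  have hrF : (r : F) ≠ 0 := fun h => by
    obtain ⟨p, hp⟩ := CharP.exists F
    obtain ⟨k, hpp, hk⟩ := FiniteField.card F p
    rw [CharP.cast_eq_zero_iff F p, Nat.prime_dvd_prime_iff_eq hpp hr] at h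
    subst h
    rw [← hq] at hk
    rw [hk, Nat.coprime_pow_left_iff k.pos, Nat.coprime_self] at hrq
    omega
  obtain ⟨A, hA, hdeg⟩ :=
    exists_le_mul_of_dvd_pow_sub_one hr (hr.odd_of_ne_two (by omega)) hq1 hrq
  have hε : 0 < 1 - 2 * entropy q θ := by linarith
  obtain ⟨Y, hY⟩ := exists_forall_growth_lt_one (q := q) (by exact_mod_cast hq1) hε hA
  refine ⟨r, Y, by omega, hr, fun s hs β hβ => ?_⟩
  set n := r ^ (3 * s) with hn
  have hn0 : n ≠ 0 := (pow_pos hr.pos _).ne'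
  have hl0 : r ^ (2 * s) ≠ 0 := (pow_pos hr.pos _).ne'
  have hμ : β ^ n ≠ 0 := pow_ne_zero _ hβ
  have heM : (X ^ r ^ (2 * s) - C (β ^ r ^ (2 * s)) : F[X]).Monic := monic_X_pow_sub_C _ hl0
  have hM : (X ^ n - C (β ^ n) : F[X]).Monic := monic_X_pow_sub_C _ hn0
  have hnl : n = r ^ (2 * s) * r ^ s := by rw [hn, ← pow_add]; congr 1; omega
  have hdvd : (X ^ r ^ (2 * s) - C (β ^ r ^ (2 * s)) : F[X]) ∣ X ^ n - C (β ^ n) := by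
    rw [hnl, pow_mul _ (r ^ (2 * s)), pow_mul _ (r ^ (2 * s)), C_pow (n := r ^ s)]
    exact sub_dvd_pow_sub_pow _ _ _
  obtain ⟨Φ, hΦ⟩ := hdvd
  set e : F[X] := X ^ r ^ (2 * s) - C (β ^ r ^ (2 * s)) with he
  have hΦM : Φ.Monic := heM.of_mul_monic_left (hΦ ▸ hM)
  have hmin : ∃ d, r ^ (2 * s) ≤ A * d := ⟨r ^ (2 * s), Nat.le_mul_of_pos_left _ hA⟩
  classical
  -- This is `r ^ (2 s) / A` rounded up, the lower bound for the degrees of the irreducible factors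
  -- of `Φ`.
  set d := Nat.find hmin with hd
  have hd1 : r ^ (2 * s) ≤ A * d := Nat.find_spec hmin
  have hd2 : ∀ D, r ^ (2 * s) ≤ A * D → d ≤ D := fun D hD => Nat.find_min' hmin hD
  have hΦn : Φ.natDegree ≤ n := by
    have := congrArg natDegree hΦ
    rw [natDegree_X_pow_sub_C, heM.natDegree_mul hΦM] at this
    omega
  obtain ⟨G, hGcard, hG1, hG2, hG3⟩ := exists_finset_divisors (d := d) (m := A * r ^ s) heM hΦM
    (fun p hp hpΦ => hd2 _ <| hdeg _ _ hp.natDegree_pos.ne' <|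
      (pow_dvd_pow r (Nat.le_succ _)).trans <|
        dvd_card_pow_natDegree_sub_one hr hrF (show 2 * s ≤ 3 * s by omega) hβ hΦ.symm hp hpΦ)
    (fun j hj => by
      refine Nat.le_of_mul_le_mul_left (c := r ^ (2 * s)) ?_ (Nat.pos_of_ne_zero hl0)
      calc r ^ (2 * s) * j ≤ A * d * j := Nat.mul_le_mul_right _ hd1
        _ = A * (j * d) := by ring
        _ ≤ A * (r ^ (2 * s) * r ^ s) := Nat.mul_le_mul_left _ (hnl ▸ hj.trans hΦn)
        _ = _ := by ring)
  rw [← hΦ] at hG1 hG2 hG3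
  rw [natDegree_X_pow_sub_C] at hG3
  refine ⟨e, Φ, heM, hΦM, hΦ.symm, natDegree_X_pow_sub_C, ?_⟩
  refine exists_multiplier hn0 hμ ⟨Φ, hΦ⟩ h0 h1 hent.le G hG1 hG2 hG3 ?_
  refine lt_of_le_of_lt ?_ (hY (r ^ s) d (hs.trans (Nat.lt_pow_self hr.one_lt).le) ?_)
  · have h3 : (n : ℝ) = ((r ^ s : ℕ) : ℝ) ^ 3 := by
      rw [hn]; push_cast; ring
    rw [h3]
    gcongr
    exact_mod_cast hGcard
  · rwa [← pow_mul, mul_comm s 2]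

/-! ### From words of length `n` to double twisted codes. -/

section Repetition

variable {F : Type*} [Field F]

/-- The polynomial `(X ^ (a n) - μ ^ a) / (X ^ n - μ)`. -/
noncomputable def cofactor (n a : ℕ) (μ : F) : F[X] :=
  ∑ i ∈ Finset.range a, (X ^ n) ^ i * C μ ^ (a - 1 - i)

theorem cofactor_mul (n a : ℕ) (μ : F) :
    cofactor n a μ * (X ^ n - C μ) = X ^ (a * n) - C (μ ^ a) := by
  rw [cofactor, geom_sum₂_mul, ← pow_mul, mul_comm n, C_pow]

theorem coeff_mul_cofactor {n a : ℕ} {μ : F} {u : F[X]} (hu : u.degree < n) {j k : ℕ} (hj : j < n)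
    (hk : k < a) : (u * cofactor n a μ).coeff (j + n * k) = u.coeff j * μ ^ (a - 1 - k) := by
  have h : ∀ i, u * ((X ^ n) ^ i * C μ ^ (a - 1 - i)) = u * C (μ ^ (a - 1 - i)) * X ^ (n * i) :=
    fun i => by rw [C_pow, pow_mul]; ring
  rw [cofactor, Finset.mul_sum, finsetSum_coeff, Finset.sum_eq_single k]
  · rw [h, coeff_mul_X_pow, coeff_mul_C]
  · intro i _ hik
    rw [h, coeff_mul_X_pow']
    split_ifs with hle
    · rw [coeff_mul_C, coeff_eq_zero_of_degree_lt, zero_mul]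
      refine hu.trans_le ?_
      have hik' : i + 1 ≤ k := by
        by_contra hcon
        have : n * (k + 1) ≤ n * i := Nat.mul_le_mul_left _ (by omega)
        rw [mul_add] at this
        omega
      have := Nat.mul_le_mul_left n hik'
      rw [mul_add] at this
      exact_mod_cast (by omega : n ≤ j + n * k - n * i)
    · rfl
  · intro h
    exact absurd (Finset.mem_range.2 hk) h

open Classical in
/-- Multiplication by the cofactor repeats a constacyclic word `a` times up to scalars. -/
theorem hammingNorm_word_mul_cofactor {lam : Fˣ} {n a : ℕ} (hn : n ≠ 0) (ha : a ≠ 0) {μ : F}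
    (hμ : μ ^ a = lam) (p : F[X]) :
    hammingNorm (word lam (a * n) (Ideal.Quotient.mk _ (p * cofactor n a μ))) =
      a * (p %ₘ (X ^ n - C μ)).support.card := by
  have hM : (X ^ n - C μ : F[X]).Monic := monic_X_pow_sub_C μ hn
  have hL : (X ^ (a * n) - C (lam : F)).Monic := monic_X_pow_sub_C _ (mul_ne_zero ha hn)
  have hμ0 : μ ≠ 0 := fun h => lam.ne_zero (by rw [← hμ, h, zero_pow ha])
  have hcM := cofactor_mul n a μ
  rw [hμ] at hcM
  set u := p %ₘ (X ^ n - C μ) with hu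
  have hudeg : u.degree < n :=
    (degree_modByMonic_lt _ hM).trans_eq (degree_X_pow_sub_C (Nat.pos_of_ne_zero hn) μ)
  have hc0 : (cofactor n a μ).Monic := hM.of_mul_monic_right (hcM ▸ hL)
  have hmod : (p * cofactor n a μ) %ₘ (X ^ (a * n) - C (lam : F)) = u * cofactor n a μ := by
    have h1 : X ^ (a * n) - C (lam : F) ∣ p * cofactor n a μ - u * cofactor n a μ := by
      refine ⟨p /ₘ (X ^ n - C μ), ?_⟩
      have := modByMonic_add_div p (X ^ n - C μ)
      rw [← hcM]
      linear_combination (-cofactor n a μ) * this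
    rw [modByMonic_eq_of_dvd_sub hL h1, modByMonic_eq_self_iff hL, ← hcM, degree_mul, degree_mul,
      add_comm]
    refine (WithBot.add_lt_add_iff_left (degree_ne_bot.2 hc0.ne_zero)).2 ?_
    exact degree_modByMonic_lt _ hM
  have hcard : u.support.card = (Finset.univ.filter fun j : Fin n => u.coeff j ≠ 0).card := by
    symm
    refine Finset.card_bij (fun j _ => (j : ℕ)) ?_ ?_ ?_
    · intro j hj
      exact mem_support_iff.2 (Finset.mem_filter.1 hj).2
    · intro j _ j' _ h
      exact Fin.ext h
    · intro j hj
      have hjn : j < n := by exact_mod_cast (le_degree_of_mem_supp _ hj).trans_lt hudeg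
      exact ⟨⟨j, hjn⟩, by simpa using mem_support_iff.1 hj, rfl⟩
  have hbij : hammingNorm (word lam (a * n) (Ideal.Quotient.mk _ (p * cofactor n a μ))) =
      ((Finset.univ : Finset (Fin a)) ×ˢ
        (Finset.univ.filter fun j : Fin n => u.coeff j ≠ 0)).card := by
    symm
    -- Position `j + n k` carries `u.coeff j` times a power of `μ`, so each nonzero coefficient of
    -- `u` is seen once in each of the `a` blocks.
    refine Finset.card_equiv finProdFinEquiv fun x => ?_
    simp only [Finset.mem_product, Finset.mem_univ, true_and, Finset.mem_filter]
    rw [word_mk lam (mul_ne_zero ha hn), hmod, finProdFinEquiv_apply_val,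
      coeff_mul_cofactor hudeg x.2.2 x.1.2]
    simp [hμ0]
  rw [hbij, Finset.card_product, Finset.card_univ, Fintype.card_fin, hcard]

end Repetition

theorem natCard_quotient_span_singleton {F : Type*} [Field F] [Fintype F] {Φ : F[X]}
    (hΦ : Φ.Monic) : Nat.card (F[X] ⧸ Ideal.span {Φ}) = Fintype.card F ^ Φ.natDegree := by
  have hfin : Module.Finite F (AdjoinRoot Φ) := hΦ.finite_adjoinRoot
  change Nat.card (AdjoinRoot Φ) = _
  rw [Module.natCard_eq_pow_finrank (K := F), Nat.card_eq_fintype_card,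
    (AdjoinRoot.powerBasis' hΦ).finrank, AdjoinRoot.powerBasis'_dim]

/-- The code is generated by `(e, e b)`, each entry multiplied by its cofactor. The first entry
alone already forces the annihilator of the generator to be `⟨Φ⟩`, so the code is isomorphic to
`F[X]/⟨Φ⟩`, and each codeword repeats the pair `(u, u b)` with `u = p e` reduced modulo `X ^ n - μ`.
-/
theorem exists_code {F : Type*} [Field F] [Fintype F] {lam : Fˣ} {a' a n : ℕ} (ha' : a' ≠ 0)
    (ha : a ≠ 0) (hn : n ≠ 0) {μ : F} (hμ' : μ ^ a' = lam) (hμ : μ ^ a = lam) {e Φ : F[X]}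
    (he : e.Monic) (hΦ : Φ.Monic) (heΦ : e * Φ = X ^ n - C μ) (hdeg : 0 < Φ.natDegree) {B : ℝ}
    {b : F[X]} (hb : ∀ u : F[X], u.degree < n → u ≠ 0 → e ∣ u →
      B < (u.support.card : ℝ) + ((u * b) %ₘ (X ^ n - C μ)).support.card) :
    ∃ K : Code lam a' a n, Nat.card K = Fintype.card F ^ Φ.natDegree ∧
      ((min a' a : ℕ) : ℝ) * B < minWeight K := by
  classical
  have hM : (X ^ n - C μ : F[X]).Monic := monic_X_pow_sub_C μ hn
  have hMdeg : (X ^ n - C μ : F[X]).degree = n := degree_X_pow_sub_C (Nat.pos_of_ne_zero hn) μ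
  have hc' := cofactor_mul n a' μ
  have hc := cofactor_mul n a μ
  rw [hμ'] at hc'
  rw [hμ] at hc
  have hL' : (X ^ (a' * n) - C (lam : F)).Monic := monic_X_pow_sub_C _ (mul_ne_zero ha' hn)
  have hc0' : cofactor n a' μ ≠ 0 := fun h => hL'.ne_zero (by rw [← hc', h, zero_mul])
  let gen : Circle lam (a' * n) × Circle lam (a * n) :=
    (Ideal.Quotient.mk _ (e * cofactor n a' μ), Ideal.Quotient.mk _ (e * b * cofactor n a μ))
  have hsmul : ∀ p : F[X], p • gen = (Ideal.Quotient.mk _ (p * e * cofactor n a' μ),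
      Ideal.Quotient.mk _ (p * e * b * cofactor n a μ)) := fun p => by
    rw [show p * e * cofactor n a' μ = p * (e * cofactor n a' μ) by ring,
      show p * e * b * cofactor n a μ = p * (e * b * cofactor n a μ) by ring]
    rfl
  have hzero : ∀ p : F[X], p • gen = 0 ↔ Φ ∣ p := fun p => by
    rw [hsmul, Prod.mk_eq_zero, Ideal.Quotient.eq_zero_iff_dvd, Ideal.Quotient.eq_zero_iff_dvd,
      ← hc', ← hc, ← heΦ]
    constructor
    · rintro ⟨h, -⟩
      rw [mul_comm (p * e), mul_dvd_mul_iff_left hc0', mul_comm p,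
        mul_dvd_mul_iff_left he.ne_zero] at h
      exact h
    · rintro ⟨k, rfl⟩
      exact ⟨⟨k, by ring⟩, ⟨k * b, by ring⟩⟩
  have hgen : gen ≠ 0 := fun h => by
    have h1 := (hzero 1).1 (by rw [h, smul_zero])
    rw [hΦ.eq_one_of_isUnit (isUnit_of_dvd_one h1)] at hdeg
    simp at hdeg
  refine ⟨Submodule.span F[X] {gen}, ?_, ?_⟩
  · have hker : LinearMap.ker (LinearMap.toSpanSingleton F[X] _ gen) = Ideal.span {Φ} := by
      ext p
      rw [LinearMap.mem_ker, LinearMap.toSpanSingleton_apply, hzero, Ideal.mem_span_singleton]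
    rw [← natCard_quotient_span_singleton hΦ, ← hker, LinearMap.span_singleton_eq_range]
    exact (Nat.card_congr
      (LinearMap.toSpanSingleton F[X] _ gen).quotKerEquivRange.toEquiv).symm
  · have hne : {w : ℕ | ∃ c ∈ Submodule.span F[X] {gen}, c ≠ 0 ∧ weight c = w}.Nonempty :=
      ⟨_, gen, Submodule.mem_span_singleton_self gen, hgen, rfl⟩
    obtain ⟨c, hc1, hc2, hc3⟩ := Nat.sInf_mem hne
    rw [minWeight, ← hc3]
    obtain ⟨p, rfl⟩ := Submodule.mem_span_singleton.1 hc1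
    set u := (p * e) %ₘ (X ^ n - C μ) with hu
    have hu0 : u ≠ 0 := fun h => hc2 <| (hzero p).2 <| by
      rw [hu, modByMonic_eq_zero_iff_dvd hM, ← heΦ, mul_comm p] at h
      exact (mul_dvd_mul_iff_left he.ne_zero).1 h
    have heu : e ∣ u := by
      have := modByMonic_add_div (p * e) (X ^ n - C μ)
      refine (dvd_add_left (Dvd.intro Φ heΦ |>.mul_right _)).1 (this ▸ dvd_mul_left e p)
    have hub : (p * e * b) %ₘ (X ^ n - C μ) = (u * b) %ₘ (X ^ n - C μ) := by
      refine modByMonic_eq_of_dvd_sub hM ⟨((p * e) /ₘ (X ^ n - C μ)) * b, ?_⟩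
      have := modByMonic_add_div (p * e) (X ^ n - C μ)
      linear_combination (-b) * this
    have hwt : weight (p • gen) =
        a' * u.support.card + a * ((u * b) %ₘ (X ^ n - C μ)).support.card := by
      rw [hsmul, weight]
      simp only
      rw [← hub, ← hammingNorm_word_mul_cofactor hn ha' hμ',
        ← hammingNorm_word_mul_cofactor hn ha hμ]
    have hlt := hb u ((degree_modByMonic_lt _ hM).trans_eq hMdeg) hu0 heu
    have hmin : 0 < ((min a' a : ℕ) : ℝ) := by
      exact_mod_cast (lt_min (Nat.pos_of_ne_zero ha') (Nat.pos_of_ne_zero ha))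
    calc ((min a' a : ℕ) : ℝ) * B
        < (min a' a : ℕ) * ((u.support.card : ℝ) +
            ((u * b) %ₘ (X ^ n - C μ)).support.card) := mul_lt_mul_of_pos_left hlt hmin
      _ ≤ weight (p • gen) := by
        rw [hwt, mul_add]
        exact_mod_cast Nat.add_le_add (Nat.mul_le_mul_right _ (min_le_left _ _))
          (Nat.mul_le_mul_right _ (min_le_right _ _))

end DoubleTwisted

/-! ### Assembly. -/

theorem theorem3p2 {F : Type*} [Field F] [Fintype F] (lam : Fˣ) (a' a : ℕ)
    (ha' : 0 < a') (ha : 0 < a)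
    (hmod : a' ≡ a [MOD orderOf lam]) (hcop : Nat.Coprime a (orderOf lam))
    (δ : ℝ) (hδ0 : 0 < δ) (hδ1 : δ < 1 - 1 / (Fintype.card F : ℝ))
    (hdom : ((a' : ℝ) + a) / (2 * ((min a' a : ℕ) : ℝ)) * δ ≤ 1 - 1 / (Fintype.card F : ℝ))
    (hent : DoubleTwisted.entropy (Fintype.card F)
      (((a' : ℝ) + a) / (2 * ((min a' a : ℕ) : ℝ)) * δ) < 1 / 2) :
    ∃ (n : ℕ → ℕ) (K : (i : ℕ) → DoubleTwisted.Code lam a' a (n i)),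
      (∀ i, 0 < n i ∧ Nat.Coprime (n i) (Fintype.card F * orderOf lam)) ∧
      Tendsto (fun i => DoubleTwisted.length (K i)) atTop atTop ∧
      Tendsto (fun i => DoubleTwisted.rate (K i)) atTop (𝓝 (1 / ((a' : ℝ) + a))) ∧
      ∀ i, δ < DoubleTwisted.relDist (K i) := by
  have hmin : (0 : ℝ) < ((min a' a : ℕ) : ℝ) := by exact_mod_cast lt_min ha' ha
  have haa : (0 : ℝ) < (a' : ℝ) + a := by positivity
  set θ := ((a' : ℝ) + a) / (2 * ((min a' a : ℕ) : ℝ)) * δ with hθ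
  have hθ0 : 0 < θ := by positivity
  set q := Fintype.card F with hq
  have hq1 : 1 < q := Fintype.one_lt_card
  have ht : 0 < orderOf lam := orderOf_pos lam
  obtain ⟨r, s₀, hrN, hr, hgood⟩ :=
    DoubleTwisted.exists_good_multipliers (F := F) (q * orderOf lam) hθ0 hdom hent
  have hcopr : Nat.Coprime r (q * orderOf lam) :=
    hr.coprime_iff_not_dvd.2 fun h => by
      have := Nat.le_of_dvd (Nat.mul_pos (by omega) ht) h
      omega
  have hcode : ∀ i : ℕ, ∃ K : DoubleTwisted.Code lam a' a (r ^ (3 * (s₀ + 1 + i))),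
      Nat.card K = q ^ (r ^ (3 * (s₀ + 1 + i)) - r ^ (2 * (s₀ + 1 + i))) ∧
      ((min a' a : ℕ) : ℝ) * (2 * θ * (r ^ (3 * (s₀ + 1 + i)) : ℕ)) <
        DoubleTwisted.minWeight K := fun i => by
    -- The summand `1` ensures `s ≥ 1`, so that `r ^ (2 s) < n` and `Φ` is not constant.
    set s := s₀ + 1 + i with hs
    set n := r ^ (3 * s) with hn
    have hn0 : n ≠ 0 := (pow_pos hr.pos _).ne'
    have hcopn : Nat.Coprime (a * n) (orderOf lam) :=
      hcop.mul_left ((hcopr.coprime_mul_left_right).pow_left _)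
    -- Since `a n` is coprime to `orderOf lam`, `lam` is a power of `lam ^ (a n)`. With `β = lam ^
    -- m`, the element `μ = β ^ n` is an `a`-th root of `lam`; its order divides `orderOf lam`, so
    -- `a' ≡ a` makes it an `a'`-th root too.
    obtain ⟨m, hm⟩ := exists_pow_eq_self_of_coprime hcopn
    have hβ : ((lam ^ m) ^ n) ^ a = lam := by
      rw [← pow_mul, mul_comm n a, ← pow_mul, mul_comm m, pow_mul, hm]
    have hβ' : ((lam ^ m) ^ n) ^ a' = lam := by
      refine (pow_eq_pow_iff_modEq.2 (hmod.of_dvd ?_)).trans hβ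
      rw [← pow_mul]
      exact orderOf_pow_dvd _
    obtain ⟨e, Φ, he, hΦ, heΦ, hed, b, hb⟩ :=
      hgood s (by omega) ((lam ^ m : Fˣ) : F) (Units.ne_zero _)
    have hdeg : Φ.natDegree = n - r ^ (2 * s) := by
      have := congrArg natDegree heΦ
      rw [natDegree_X_pow_sub_C, he.natDegree_mul hΦ, hed] at this
      omega
    have hlt : r ^ (2 * s) < n := Nat.pow_lt_pow_right hr.one_lt (by omega)
    obtain ⟨K, hK1, hK2⟩ := DoubleTwisted.exists_code ha'.ne' ha.ne' hn0
      (by exact_mod_cast congrArg Units.val hβ') (by exact_mod_cast congrArg Units.val hβ)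
      he hΦ heΦ (by omega) hb
    exact ⟨K, by rw [hK1, hdeg], hK2⟩
  choose K hK1 hK2 using hcode
  have hrR : (1 : ℝ) < r := by exact_mod_cast hr.one_lt
  have hlen : ∀ i, DoubleTwisted.length (K i) = (a' + a) * r ^ (3 * (s₀ + 1 + i)) := fun i => by
    rw [DoubleTwisted.length, add_mul]
  refine ⟨fun i => r ^ (3 * (s₀ + 1 + i)), K, fun i => ⟨pow_pos hr.pos _, hcopr.pow_left _⟩,
    ?_, ?_, fun i => ?_⟩
  · refine tendsto_atTop_mono (fun i => ?_) tendsto_id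
    rw [hlen]
    calc i ≤ 3 * (s₀ + 1 + i) := by omega
      _ ≤ r ^ (3 * (s₀ + 1 + i)) := (Nat.lt_pow_self hr.one_lt).le
      _ ≤ _ := Nat.le_mul_of_pos_left _ (by omega)
  · have hrate : ∀ i, DoubleTwisted.rate (K i) =
        (1 - ((r : ℝ)⁻¹) ^ (s₀ + 1 + i)) * (1 / ((a' : ℝ) + a)) := fun i => by
      rw [DoubleTwisted.rate, hK1, hlen, ← hq, Nat.cast_pow, Real.logb_pow,
        Real.logb_self_eq_one (by exact_mod_cast hq1), mul_one,
        Nat.cast_sub (Nat.pow_le_pow_right hr.pos (by omega))]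
      push_cast
      have hr0 : (r : ℝ) ≠ 0 := by linarith
      rw [inv_pow]
      set s := s₀ + 1 + i
      rw [show 3 * s = 2 * s + s by ring, pow_add]
      have h2 : (r : ℝ) ^ (2 * s) ≠ 0 := pow_ne_zero _ hr0
      have h3 : (r : ℝ) ^ s ≠ 0 := pow_ne_zero _ hr0
      field_simp
    simp_rw [hrate]
    have h1 : Tendsto (fun i : ℕ => ((r : ℝ)⁻¹) ^ (s₀ + 1 + i)) atTop (𝓝 0) :=
      (tendsto_pow_atTop_nhds_zero_of_lt_one (by positivity) (inv_lt_one_of_one_lt₀ hrR)).comp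
        (tendsto_atTop_mono (fun i => Nat.le_add_left i (s₀ + 1)) tendsto_id)
    simpa using (h1.const_sub 1).mul_const (1 / ((a' : ℝ) + a))
  · have hn : (0 : ℝ) < (r : ℝ) ^ (3 * (s₀ + 1 + i)) := by positivity
    have h := hK2 i
    rw [DoubleTwisted.relDist, hlen]
    push_cast at h ⊢
    rw [lt_div_iff₀ (by positivity)]
    -- The choice of `θ` makes `min a' a * (2 θ n)` equal to `δ` times the code length.
    refine lt_of_eq_of_lt ?_ h
    push_cast at hmin
    rw [hθ]
    push_cast
    field_simp
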